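/- A \emph{dense $C$-set} is a set $M$ with a ternary relation $C$ such that for all $x,y,z,w\in M$: (C1) $C(x,y,z)\to C(x,z,y)$; (C2) $C(x,y,z)\to\neg C(y,x,z)$; (C3) $C(x,y,z)\to C(w,y,z)\vee C(x,w,z)$; (C4) $x\neq y\to C(x,y,y)$; and (D) $M$ has at least two elements and for all $x\ne y$ there is $z\neq y$ with $C(x,y,z)$. Its canonical tree $T(M)$ is the set of formal meets $\inf(\alpha,\beta)$ ($\alpha,\beta\in M$), with $\inf(\alpha,\beta)\le\inf(\gamma,\delta)$ iff $\neg C(\gamma,\alpha,\beta)$ and $\neg C(\delta,\alpha,\beta)$, two meets being identified when each is $\le$ the other; $\alpha\in M$ is identified with the leaf $\inf(\alpha,\alpha)$. Let $T$ be the set of nodes of $T(M)$ that are not leaves. For $a\in T$, a \emph{cone at $a$} is a set $\Gamma_a(\alpha)=\{\beta\in M: a<\inf(\alpha,\beta)\}$ with $\alpha\in M$, $a<\alpha$; let $\mathcal C[a]$ be the set of cones at $a$. A \emph{cone} is a cone at some $a\in T$, or $M$ itself; the cones form a basis of a topology on $M$. Let $L$ be a first-order language with a distinguished ternary relation symbol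 $C$, and let $M$ be an $L$-structure such that $(M,C)$ is a dense $C$-set and $M$ is \emph{$C$-minimal}: for every $N\equiv M$, every subset of $N$ definable with parameters is definable with parameters by a quantifier-free formula using only the predicate $C$. Assume that $\mathcal C[b]$ is infinite for every $b\in T$ and that for every $\alpha\in M$ the branch $\{b\in T: b\leq\alpha\}$ is densely ordered. Let $a\in T$ and let $f$ be a partial function from $M$ to $\mathcal C[a]$ that is definable with parameters, i.e. $\{(x,y)\in M^2: x\in\operatorname{dom}(f),\ y\in f(x)\}$ is definable with parameters. Then $f$ is locally constant on a cofinite subset of its domain: there is $X\subseteq\operatorname{dom}(f)$ with $\operatorname{dom}(f)\setminus X$ finite such that every $\alpha\in X$ lies in a cone $U\subseteq X$ on which $f$ is constant. -/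

import Mathlib

open scoped FirstOrder

universe u v w

namespace CMinimal

/-- The axioms (C1)-(C4) of a `C`-set. -/
structure IsCSet {M : Type w} (C : M → M → M → Prop) : Prop where
  c1 : ∀ x y z, C x y z → C x z y
  c2 : ∀ x y z, C x y z → ¬ C y x z
  c3 : ∀ x y z t, C x y z → (C t y z ∨ C x t z)
  c4 : ∀ x y, x ≠ y → C x y y

/-- A dense `C`-set: a `C`-set that also satisfies axiom (D). -/
structure IsDenseCSet {M : Type w} (C : M → M → M → Prop) : Prop extends IsCSet C where
  exists_ne : ∃ x y : M, x ≠ y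
  dense : ∀ x y, x ≠ y → ∃ z, z ≠ y ∧ C x y z

section Tree

variable {M : Type w} {C : M → M → M → Prop}

/-- The order on pairs of points, where `(α, β)` stands for the node `inf(α, β)`:
`inf(α, β) ≤ inf(γ, δ)` iff neither `C(γ, α, β)` nor `C(δ, α, β)`. -/
def PairLE (C : M → M → M → Prop) (p q : M × M) : Prop :=
  ¬ C q.1 p.1 p.2 ∧ ¬ C q.2 p.1 p.2

theorem IsCSet.pairLE_refl (h : IsCSet C) (p : M × M) : PairLE C p p :=
  ⟨fun hp => h.c2 _ _ _ hp hp, fun hp => h.c2 _ _ _ (h.c1 _ _ _ hp) (h.c1 _ _ _ hp)⟩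

theorem IsCSet.not_C_trans (h : IsCSet C) {a b c d x : M} (hc : ¬ C c a b) (hd : ¬ C d a b)
    (hx : ¬ C x c d) : ¬ C x a b := by
  intro hxab
  have h1 : C x c b := (h.c3 _ _ _ c hxab).resolve_left hc
  have h2 : C x d b := (h.c3 _ _ _ d hxab).resolve_left hd
  have h3 : C d b c := (h.c3 _ _ _ d (h.c1 _ _ _ h1)).resolve_right
    (fun h' => hx (h.c1 _ _ _ h'))
  have h4 : C c b d := (h.c3 _ _ _ c (h.c1 _ _ _ h2)).resolve_right hx
  exact h.c2 _ _ _ (h.c1 _ _ _ h3) (h.c1 _ _ _ h4)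

/-- Pairs of points with the preorder `PairLE`. -/
abbrev IsCSet.pairPreorder (h : IsCSet C) : Preorder (M × M) where
  le := PairLE C
  le_refl := h.pairLE_refl
  le_trans _ _ _ hpq hqr :=
    ⟨h.not_C_trans hpq.1 hpq.2 hqr.1, h.not_C_trans hpq.1 hpq.2 hqr.2⟩

theorem IsCSet.isPreorder_pairLE (h : IsCSet C) : IsPreorder (M × M) (PairLE C) where
  refl := h.pairPreorder.le_refl
  trans := h.pairPreorder.le_trans

/-- The canonical tree `T(M)` of a `C`-set: pairs of points modulo the equivalence relation
of the preorder `PairLE`. -/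
def Tree (h : IsCSet C) : Type w :=
  @Antisymmetrization (M × M) (PairLE C) h.isPreorder_pairLE

instance Tree.instPartialOrder (h : IsCSet C) : PartialOrder (Tree h) :=
  @instPartialOrderAntisymmetrization (M × M) h.pairPreorder

/-- The node `inf(α, β)` of `T(M)`, for `α, β ∈ M`. -/
def Tree.meet (h : IsCSet C) (α β : M) : Tree h :=
  @toAntisymmetrization (M × M) (PairLE C) h.isPreorder_pairLE (α, β)

/-- The leaf of `T(M)` identified with the point `α` of `M`. -/
def Tree.leaf (h : IsCSet C) (α : M) : Tree h := Tree.meet h α α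

theorem Tree.meet_le_meet (h : IsCSet C) (α β γ δ : M) :
    Tree.meet h α β ≤ Tree.meet h γ δ ↔ ¬ C γ α β ∧ ¬ C δ α β := Iff.rfl

/-- `Tree.meet h α β` is indeed the infimum of the leaves `α` and `β`. -/
theorem Tree.isGLB_meet (h : IsCSet C) (α β : M) :
    IsGLB {Tree.leaf h α, Tree.leaf h β} (Tree.meet h α β) := by
  refine ⟨?_, ?_⟩
  · rintro x (rfl | rfl)
    · exact ⟨(h.pairLE_refl (α, β)).1, (h.pairLE_refl (α, β)).1⟩
    · exact ⟨(h.pairLE_refl (α, β)).2, (h.pairLE_refl (α, β)).2⟩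
  · intro x hx
    induction x using Quotient.inductionOn with
    | h p =>
      have h1 := hx (Set.mem_insert _ _)
      have h2 := hx (Set.mem_insert_of_mem _ (Set.mem_singleton _))
      exact ⟨h1.1, h2.1⟩

/-- `T`: the set of nodes of `T(M)` that are not leaves. -/
def innerNodes (h : IsCSet C) : Set (Tree h) := {a | ∀ α : M, a ≠ Tree.leaf h α}

/-- The part in `T` of the branch of `α ∈ M`. -/
def branch (h : IsCSet C) (α : M) : Set (Tree h) := {a ∈ innerNodes h | a ≤ Tree.leaf h α}

/-- The cone `Γ_a(α) = {β ∈ M : a < inf(α, β)}`, as a subset of `M` (used for `a < α`). -/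
def cone (h : IsCSet C) (a : Tree h) (α : M) : Set M := {β | a < Tree.meet h α β}

/-- The set `𝒞[a]` of cones at `a`, as subsets of `M`. -/
def conesAt (h : IsCSet C) (a : Tree h) : Set (Set M) :=
  {U | ∃ α : M, a < Tree.leaf h α ∧ U = cone h a α}

/-- The set `𝒞` of all cones, including `M` (the cone at `-∞`); it is the basis of the topology
of `M`. -/
def cones (h : IsCSet C) : Set (Set M) :=
  {U | U = Set.univ ∨ ∃ a ∈ innerNodes h, U ∈ conesAt h a}

/-- The partial function `f` is locally constant on `X` (for the topology on `M` with the cones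
as a basis): every point of `X` lies in a cone that is contained in `X` and on which `f` is defined
and constant. -/
def LocallyConstantOn {Y : Type*} (h : IsCSet C) (f : M →. Y) (X : Set M) : Prop :=
  ∀ α ∈ X, ∃ U ∈ cones h, α ∈ U ∧ U ⊆ X ∧ ∃ y : Y, ∀ β ∈ U, y ∈ f β

end Tree

section ModelTheory

/-- The relation symbols of the language of `C`-sets: one ternary symbol. -/
inductive CRel : ℕ → Type
  | C : CRel 3

/-- The language with one ternary relation symbol. -/
def langC : FirstOrder.Language := ⟨fun _ => Empty, CRel⟩

variable {L : FirstOrder.Language.{u, v}}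

/-- The interpretation of `langC` in a language `L` with a distinguished ternary relation
symbol. -/
def langCHom (c : L.Relations 3) : langC →ᴸ L where
  onFunction := fun _ f => nomatch f
  onRelation := fun _ r => match r with | CRel.C => c

/-- The ternary relation on an `L`-structure named by the distinguished symbol. -/
def cRel (c : L.Relations 3) (N : Type*) [L.Structure N] (x y z : N) : Prop :=
  FirstOrder.Language.Structure.RelMap c ![x, y, z]

/-- `D ⊆ N` is definable, with parameters from `N`, by a quantifier-free formula using only the
predicate `C`. The variables `Sum.inl n` are evaluated at the parameter `n`. -/
def QFCDefinable (c : L.Relations 3) {N : Type*} [L.Structure N] (D : Set N) : Prop :=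
  ∃ φ : langC.Formula (N ⊕ Unit), φ.IsQF ∧
    ∀ x : N, x ∈ D ↔ ((langCHom c).onFormula φ).Realize (Sum.elim id fun _ => x)

/-- `C`-minimality of `M`: in every `N ≡ M`, every definable (with parameters) subset of `N` is
quantifier-free definable from `C`. By Löwenheim-Skolem, structures `N` in the universe of `L` and
`M` suffice. -/
def IsCMinimal (c : L.Relations 3) (M : Type w) [L.Structure M] : Prop :=
  ∀ (N : Type (max u v w)) [L.Structure N], L.ElementarilyEquivalent M N →
    ∀ D : Set N, (Set.univ : Set N).Definable₁ L D → QFCDefinable c D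

/-- A partial function from `M` to the set of cones at `a` is definable (with parameters) if the
relation "`x ∈ dom f` and `y ∈ f x`" on `M` is definable. -/
def DefinableToCones (L : FirstOrder.Language.{u, v}) {M : Type w} [L.Structure M]
    {C : M → M → M → Prop}
    {h : IsCSet C} {a : Tree h} (f : M →. conesAt h a) : Prop :=
  (Set.univ : Set M).Definable₂ L {p : M × M | ∃ U ∈ f p.1, p.2 ∈ (U : Set M)}

end ModelTheory

end CMinimal

/-! By quantifier elimination in `C` alone, membership in a definable set depends only on the
position relative to a finite set, so a definable set is finite or contains a cone
(`HasFiniteBase.finite_or_exists_cone`). The set of points of the domain near which `f` is not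
constant is definable. If it were infinite it would contain a cone, so it suffices to find a subcone
on which `f` is constant (`IsCMinimal.exists_cone_constant`).

Suppose there is none. Then every fibre of `f` in the given cone is finite. Take infinitely many
disjoint cones `V i` at a node `b` inside it. Each image of `V i` is infinite and definable, hence
contains all but finitely many cones at `a`. For every `k`, some value is therefore attained in each
of `V 0, ..., V (k - 1)`, so the finite fibres have unbounded size. An ultrapower then has an
infinite fibre, which contains a cone by `C`-minimality there; by Łoś's theorem some fibre in `M`
contains a cone as well (`IsCMinimal.exists_cone_of_unbounded`), a contradiction. -/

namespace CMinimal

/-! ### Combinatorics of `C`-sets: finite bases and cones. -/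

section CSet

variable {M : Type*} {C : M → M → M → Prop}

theorem IsCSet.not_C_left (h : IsCSet C) (x y : M) : ¬ C x x y := fun hx => h.c2 _ _ _ hx hx

theorem IsCSet.not_C_right (h : IsCSet C) (x y : M) : ¬ C x y x :=
  fun hx => h.not_C_left _ _ (h.c1 _ _ _ hx)

/-- The points `x` and `y` are outside `S` and branch off from every point of `S` at the
same node. -/
def Indiscernible (C : M → M → M → Prop) (S : Set M) (x y : M) : Prop :=
  ∀ s ∈ S, x ≠ s ∧ y ≠ s ∧ ¬ C x y s ∧ ¬ C y x s

theorem Indiscernible.symm {S : Set M} {x y : M} (hxy : Indiscernible C S x y) :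
    Indiscernible C S y x := fun s hs =>
  ⟨(hxy s hs).2.1, (hxy s hs).1, (hxy s hs).2.2.2, (hxy s hs).2.2.1⟩

theorem Indiscernible.mono {S S' : Set M} (hS : S ⊆ S') {x y : M}
    (hxy : Indiscernible C S' x y) : Indiscernible C S x y := fun s hs => hxy s (hS hs)

/-- A set with a finite base: membership depends only on the position relative to a finite set. -/
def HasFiniteBase (C : M → M → M → Prop) (D : Set M) : Prop :=
  ∃ S : Set M, S.Finite ∧ ∀ x y, Indiscernible C S x y → (x ∈ D → y ∈ D)

/-- If `x ∉ S` with `S` finite, some cone around `x` consists of points indiscernible from `x`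
over `S`. -/
theorem IsCSet.exists_cone_avoiding (h : IsCSet C) {x x' : M} (hx' : x' ≠ x) {S : Set M}
    (hS : S.Finite) (hx : x ∉ S) : ∃ p, p ≠ x ∧ ∀ s ∈ S, ∀ y, C p x y → C s x y := by
  induction S, hS using Set.Finite.induction_on with
  | empty => exact ⟨x', hx', by simp⟩
  | @insert b S _ _ ih =>
    obtain ⟨p, hp, hpS⟩ := ih (fun hS => hx (Set.mem_insert_of_mem _ hS))
    have key : ∀ p b : M, ¬ C p b x → ∀ y, C p x y → C b x y := fun p b hpb y hy =>
      h.c1 _ _ _ ((h.c3 _ _ _ b (h.c1 _ _ _ hy)).resolve_right hpb)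
    -- If `b` branches off from `x` above the node where `p` does, `b` cuts out the smaller cone and
    -- replaces `p`; otherwise `p` still works.
    by_cases hpb : C p b x
    · have hbp : ¬ C b p x := h.c2 _ _ _ hpb
      refine ⟨b, fun hb => hx (hb ▸ Set.mem_insert _ _), ?_⟩
      rintro s (rfl | hs) y hy
      · exact hy
      · exact hpS s hs y (key _ _ hbp y hy)
    · refine ⟨p, hp, ?_⟩
      rintro s (rfl | hs) y hy
      · exact key _ _ hpb y hy
      · exact hpS s hs y hy

theorem IsCSet.indiscernible_of_C (h : IsCSet C) {S : Set M} {x y : M}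
    (hxy : ∀ s ∈ S, C s x y) : Indiscernible C S x y := by
  intro s hs
  have hc := hxy s hs
  refine ⟨?_, ?_, h.c2 _ _ _ hc ∘ h.c1 _ _ _, h.c2 _ _ _ (h.c1 _ _ _ hc) ∘ h.c1 _ _ _⟩
  · rintro rfl; exact h.not_C_left _ _ hc
  · rintro rfl; exact h.not_C_right _ _ hc

/-- A point of `D` outside the base brings with it a whole cone around it, since points of a small
enough cone are indiscernible over the base. -/
theorem HasFiniteBase.finite_or_exists_cone (h : IsCSet C) (hM : ∃ x y : M, x ≠ y) {D : Set M}
    (hD : HasFiniteBase C D) : D.Finite ∨ ∃ p q, p ≠ q ∧ ∀ x, C p q x → x ∈ D := by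
  obtain ⟨S, hS, hSD⟩ := hD
  by_cases hfin : D ⊆ S
  · exact Or.inl (hS.subset hfin)
  obtain ⟨x, hxD, hxS⟩ := Set.not_subset.1 hfin
  obtain ⟨x', hx'⟩ : ∃ x', x' ≠ x := by
    obtain ⟨y, z, hyz⟩ := hM
    by_cases hy : y = x
    · exact ⟨z, fun hz => hyz (hy.trans hz.symm)⟩
    · exact ⟨y, hy⟩
  obtain ⟨p, hp, hpS⟩ := h.exists_cone_avoiding hx' hS hxS
  exact Or.inr ⟨p, x, hp, fun y hy =>
    hSD x y (h.indiscernible_of_C fun s hs => hpS s hs y hy) hxD⟩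

/-- A finite cone could be shrunk around `q` until it misses all its other points, against axiom
(D). -/
theorem IsDenseCSet.infinite_cone (hC : IsDenseCSet C) {p q : M} (hpq : p ≠ q) :
    {x | C p q x}.Infinite := by
  intro hfin
  have h := hC.toIsCSet
  obtain ⟨r, hr, hrS⟩ := h.exists_cone_avoiding hpq
    (hfin.subset (Set.sdiff_subset (t := {q}))) (by simp)
  obtain ⟨p', hp', hpr⟩ := h.exists_cone_avoiding hpq (S := {p, r}) (by simp)
    (by simp [hpq.symm, hr.symm])
  obtain ⟨z, hz, hCz⟩ := hC.dense p' q hp'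
  have := hrS z ⟨hpr p (by simp) z hCz, hz⟩ z (hpr r (by simp) z hCz)
  exact h.not_C_right _ _ this

end CSet

/-! ### Quantifier-free definable sets have finite bases. -/

section QuantifierFree

open FirstOrder FirstOrder.Language

variable {L : FirstOrder.Language.{u, v}}

theorem langC_term_realize (c : L.Relations 3) {N : Type*} [L.Structure N]
    (t : langC.Term ((N ⊕ Unit) ⊕ Fin 0)) :
    (∃ n : N, ∀ (x : N) (xs : Fin 0 → N), ((langCHom c).onTerm t).realize
        (Sum.elim (Sum.elim id fun _ => x) xs) = n) ∨
      ∀ (x : N) (xs : Fin 0 → N), ((langCHom c).onTerm t).realize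
        (Sum.elim (Sum.elim id fun _ => x) xs) = x := by
  cases t with
  | var i =>
    rcases i with (n | _) | i
    · exact Or.inl ⟨n, fun _ _ => rfl⟩
    · exact Or.inr fun _ _ => rfl
    · exact i.elim0
  | func f => exact f.elim

/-- The base consists of the parameters of the formula. Symmetry of indiscernibility handles
implications; for atoms (C3) moves `x` to `y`, and (C4) settles `C(n, x, x)`. -/
theorem QFCDefinable.hasFiniteBase (c : L.Relations 3) {N : Type*} [L.Structure N]
    (h : IsCSet (cRel c N)) {D : Set N} (hD : QFCDefinable c D) :
    HasFiniteBase (cRel c N) D := by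
  obtain ⟨φ, hφ, hφD⟩ := hD
  suffices H : ∃ S : Set N, S.Finite ∧ ∀ x y, Indiscernible (cRel c N) S x y →
      (((langCHom c).onBoundedFormula φ).Realize (Sum.elim id fun _ => x) default →
        ((langCHom c).onBoundedFormula φ).Realize (Sum.elim id fun _ => y) default) by
    obtain ⟨S, hS, H⟩ := H
    exact ⟨S, hS, fun x y hxy hx => (hφD y).2 (H x y hxy ((hφD x).1 hx))⟩
  clear hφD
  induction hφ with
  | falsum => exact ⟨∅, Set.finite_empty, fun _ _ _ => id⟩
  | imp _ _ ih₁ ih₂ =>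
    obtain ⟨S₁, hS₁, h₁⟩ := ih₁
    obtain ⟨S₂, hS₂, h₂⟩ := ih₂
    refine ⟨S₁ ∪ S₂, hS₁.union hS₂, fun x y hxy hx hy => ?_⟩
    exact h₂ x y (hxy.mono Set.subset_union_right)
      (hx (h₁ y x (hxy.symm.mono Set.subset_union_left) hy))
  | of_isAtomic hφ =>
    cases hφ with
    | equal t₁ t₂ =>
      have hr : ∀ x : N, ((langCHom c).onBoundedFormula (t₁.bdEqual t₂)).Realize
          (Sum.elim id fun _ => x) default ↔
          ((langCHom c).onTerm t₁).realize (Sum.elim (Sum.elim id fun _ => x) default) =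
          ((langCHom c).onTerm t₂).realize (Sum.elim (Sum.elim id fun _ => x) default) :=
        fun x => Iff.rfl
      simp only [hr]
      rcases langC_term_realize c t₁ with ⟨n₁, h₁⟩ | h₁ <;>
      rcases langC_term_realize c t₂ with ⟨n₂, h₂⟩ | h₂ <;> simp only [h₁, h₂]
      · exact ⟨∅, Set.finite_empty, fun _ _ _ => id⟩
      · exact ⟨{n₁}, Set.finite_singleton _, fun x y hxy e => ((hxy n₁ rfl).1 e.symm).elim⟩
      · exact ⟨{n₂}, Set.finite_singleton _, fun x y hxy e => ((hxy n₂ rfl).1 e).elim⟩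
      · exact ⟨∅, Set.finite_empty, fun _ _ _ _ => trivial⟩
    | @rel k R ts =>
      cases R
      have hr : ∀ x : N, ((langCHom c).onBoundedFormula
          (Relations.boundedFormula (L := langC) CRel.C ts)).Realize
          (Sum.elim id fun _ => x) default ↔ cRel c N
          (((langCHom c).onTerm (ts 0)).realize (Sum.elim (Sum.elim id fun _ => x) default))
          (((langCHom c).onTerm (ts 1)).realize (Sum.elim (Sum.elim id fun _ => x) default))
          (((langCHom c).onTerm (ts 2)).realize (Sum.elim (Sum.elim id fun _ => x) default)) := by
        intro x
        have : ∀ g : Fin 3 → N, Structure.RelMap c g ↔ cRel c N (g 0) (g 1) (g 2) := by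
          intro g
          rw [cRel, show g = ![g 0, g 1, g 2] by ext i; fin_cases i <;> rfl]; rfl
        exact this _
      simp only [hr]
      have key : ∀ α β x y, Indiscernible (cRel c N) {α, β} x y → cRel c N α x β →
          cRel c N α y β := fun α β x y hxy hc =>
        (h.c3 _ _ _ y hc).resolve_left (hxy β (by simp)).2.2.2
      rcases langC_term_realize c (ts 0) with ⟨n₀, h₀⟩ | h₀ <;>
      rcases langC_term_realize c (ts 1) with ⟨n₁, h₁⟩ | h₁ <;>
      rcases langC_term_realize c (ts 2) with ⟨n₂, h₂⟩ | h₂ <;> simp only [h₀, h₁, h₂]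
      · exact ⟨∅, Set.finite_empty, fun _ _ _ => id⟩
      · exact ⟨{n₀, n₁}, by simp, fun x y hxy hc =>
          h.c1 _ _ _ (key n₀ n₁ x y hxy (h.c1 _ _ _ hc))⟩
      · exact ⟨{n₀, n₂}, by simp, fun x y hxy hc => key n₀ n₂ x y hxy hc⟩
      · exact ⟨{n₀}, by simp, fun x y hxy _ => h.c4 _ _ (hxy n₀ rfl).2.1.symm⟩
      · exact ⟨{n₁, n₂}, by simp, fun x y hxy hc =>
          (h.c3 _ _ _ y hc).resolve_right (hxy n₂ (by simp)).2.2.1⟩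
      · exact ⟨∅, Set.finite_empty, fun x _ _ hc => (h.not_C_right _ _ hc).elim⟩
      · exact ⟨∅, Set.finite_empty, fun x _ _ hc => (h.not_C_left _ _ hc).elim⟩
      · exact ⟨∅, Set.finite_empty, fun x _ _ hc => (h.not_C_left _ _ hc).elim⟩

theorem IsCSet.ulift {N : Type*} {C : N → N → N → Prop} (h : IsCSet C) :
    IsCSet fun x y z : ULift N => C x.down y.down z.down where
  c1 _ _ _ := h.c1 _ _ _
  c2 _ _ _ := h.c2 _ _ _
  c3 _ _ _ _ := h.c3 _ _ _ _
  c4 _ _ hxy := h.c4 _ _ fun e => hxy (ULift.down_injective e)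

/-- In a model of the theory of a `C`-minimal structure, sets definable with parameters have a
finite base. -/
theorem IsCMinimal.hasFiniteBase {c : L.Relations 3} {M : Type w} [L.Structure M]
    (hmin : IsCMinimal c M) {N : Type w} [L.Structure N] (hN : L.ElementarilyEquivalent M N)
    (h : IsCSet (cRel c N)) {β : Type*} (φ : L.Formula (β ⊕ Fin 1)) (v : β → N) :
    HasFiniteBase (cRel c N) {x | φ.Realize (Sum.elim v ![x])} := by
  -- `IsCMinimal` speaks only of structures in the larger universe, so `N` is replaced by an
  -- isomorphic copy there.
  let e : N ≃ ULift.{max u v} N := Equiv.ulift.symm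
  let _ : L.Structure (ULift.{max u v} N) := e.inducedStructure
  let E : N ≃[L] ULift.{max u v} N := e.inducedStructureEquiv
  have hC' : cRel c (ULift.{max u v} N) = fun x y z => cRel c N x.down y.down z.down := by
    funext x y z
    have : (e.symm ∘ ![x, y, z]) = ![x.down, y.down, z.down] := by
      ext i; fin_cases i <;> rfl
    change Structure.RelMap c (e.symm ∘ ![x, y, z]) = _
    rw [this]; rfl
  have hreal : ∀ x : ULift.{max u v} N, φ.Realize (Sum.elim (fun b => e (v b)) ![x]) ↔
      φ.Realize (Sum.elim v ![x.down]) := by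
    intro x
    rw [← StrongHomClass.realize_formula E φ]
    have : (Sum.elim (fun b => e (v b)) ![x]) = E ∘ Sum.elim v ![x.down] := by
      ext (b | i)
      · rfl
      · fin_cases i; rfl
    rw [this]
  have hdef : (Set.univ : Set (ULift.{max u v} N)).Definable₁ L
      {x | φ.Realize (Sum.elim (fun b => e (v b)) ![x])} := by
    refine Set.definable_iff_exists_formula_sum.2
      ⟨φ.relabel (Sum.map (fun b => ⟨e (v b), trivial⟩) id), ?_⟩
    ext z
    simp only [Set.mem_ofPred_eq, Formula.realize_relabel]
    have : (Sum.elim (fun b => e (v b)) ![z 0]) = (Sum.elim (fun x : (Set.univ :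
        Set (ULift.{max u v} N)) => (x : ULift.{max u v} N)) z ∘
          Sum.map (fun b => ⟨e (v b), trivial⟩) id) := by
      ext (b | i)
      · rfl
      · fin_cases i; rfl
    rw [this]
  have hb := (hmin _ (hN.trans (StrongHomClass.elementarilyEquivalent E)) _ hdef).hasFiniteBase c
    (hC' ▸ h.ulift)
  obtain ⟨S, hS, hSD⟩ := hb
  refine ⟨e ⁻¹' S, hS.preimage e.injective.injOn, fun x y hxy hx => ?_⟩
  refine (hreal (e y)).1 (hSD (e x) (e y) ?_ ((hreal (e x)).2 hx))
  intro s hs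
  have := hxy s.down hs
  rw [hC']
  exact ⟨fun he => this.1 (congrArg ULift.down he), fun he => this.2.1 (congrArg ULift.down he),
    this.2.2⟩

end QuantifierFree

/-! ### Uniform bounds through an ultrapower. -/

section Ultrapower

open FirstOrder FirstOrder.Language Filter

variable {L : FirstOrder.Language.{u, v}}

/-- If the members of a definable family of subsets of a `C`-minimal structure are arbitrarily
large, then one of them contains a cone. -/
theorem IsCMinimal.exists_cone_of_unbounded {c : L.Relations 3} {M : Type w} [L.Structure M]
    (hmin : IsCMinimal c M) (h : IsCSet (cRel c M)) (hM : ∃ x y : M, x ≠ y)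
    {β : Type*} (φ : L.Formula (β ⊕ Fin 2)) (v : β → M)
    (hunb : ∀ k : ℕ, ∃ (y : M) (g : ℕ → M), Set.InjOn g (Set.Iio k) ∧
      ∀ i < k, φ.Realize (Sum.elim v ![g i, y])) :
    ∃ y p q, p ≠ q ∧ ∀ x, cRel c M p q x → φ.Realize (Sum.elim v ![x, y]) := by
  choose y g hg hφ using hunb
  obtain ⟨m₀, m₁, hm⟩ := hM
  have : Nonempty M := ⟨m₀⟩
  let U : Ultrafilter ℕ := hyperfilter ℕ
  let N : Type w := (U : Filter ℕ).Product fun _ => M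
  let mk : (ℕ → M) → N := fun s => (s : (U : Filter ℕ).Product fun _ => M)
  have hmk : Function.Surjective mk := fun n => Quotient.exists_rep n
  have hEq : ∀ s t : ℕ → M, mk s = mk t ↔ ∀ᶠ i in U, s i = t i := fun s t => Quotient.eq''
  have hRel : ∀ r s t : ℕ → M, cRel c N (mk r) (mk s) (mk t) ↔
      ∀ᶠ i in U, cRel c M (r i) (s i) (t i) := by
    intro r s t
    have := Ultraproduct.realize_formula_cast (u := U) (M := fun _ => M)
      (Relations.formula c (fun i : Fin 3 => Term.var i)) ![r, s, t]
    simp only [Formula.realize_rel, Term.realize_var] at this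
    have e₁ : (fun i => (![r, s, t] i : (U : Filter ℕ).Product fun _ => M)) =
        ![mk r, mk s, mk t] := by
      ext i; fin_cases i <;> rfl
    have e₂ : ∀ j, (fun i : Fin 3 => (![r, s, t] : Fin 3 → ℕ → M) i j) = ![r j, s j, t j] := by
      intro j; ext i; fin_cases i <;> rfl
    simp only [e₂] at this
    rw [e₁] at this
    exact this
  have hReal : ∀ s t : ℕ → M, φ.Realize (Sum.elim (fun b => mk fun _ => v b) ![mk s, mk t]) ↔
      ∀ᶠ i in U, φ.Realize (Sum.elim v ![s i, t i]) := by
    intro s t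
    have := Ultraproduct.realize_formula_cast (u := U) (M := fun _ => M) φ
      (Sum.elim (fun b _ => v b) ![s, t])
    have e₁ : (fun i => ((Sum.elim (fun b _ => v b) ![s, t] : β ⊕ Fin 2 → ℕ → M) i :
        (U : Filter ℕ).Product fun _ => M)) =
        Sum.elim (fun b => mk fun _ => v b) ![mk s, mk t] := by
      ext (b | i)
      · rfl
      · fin_cases i <;> rfl
    have e₂ : ∀ j, (fun i => (Sum.elim (fun b _ => v b) ![s, t] : β ⊕ Fin 2 → ℕ → M) i j) =
        Sum.elim v ![s j, t j] := by
      intro j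
      ext (b | i)
      · rfl
      · fin_cases i <;> rfl
    simp only [e₂] at this
    rw [e₁] at this
    exact this
  have hN : L.ElementarilyEquivalent M N := by
    refine elementarilyEquivalent_iff.2 fun ψ => ?_
    rw [Ultraproduct.sentence_realize]
    simp
  have hNC : IsCSet (cRel c N) := by
    constructor
    · intro x y z
      obtain ⟨⟨x, rfl⟩, ⟨y, rfl⟩, ⟨z, rfl⟩⟩ := And.intro (hmk x) (And.intro (hmk y) (hmk z))
      simp only [hRel]
      exact fun hx => hx.mono fun _ => h.c1 _ _ _
    · intro x y z
      obtain ⟨⟨x, rfl⟩, ⟨y, rfl⟩, ⟨z, rfl⟩⟩ := And.intro (hmk x) (And.intro (hmk y) (hmk z))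
      simp only [hRel]
      intro hx hy
      obtain ⟨i, h₁, h₂⟩ := (hx.and hy).exists
      exact h.c2 _ _ _ h₁ h₂
    · intro x y z t
      obtain ⟨⟨x, rfl⟩, ⟨y, rfl⟩, ⟨z, rfl⟩⟩ := And.intro (hmk x) (And.intro (hmk y) (hmk z))
      obtain ⟨t, rfl⟩ := hmk t
      simp only [hRel, ← Ultrafilter.eventually_or]
      exact fun hx => hx.mono fun _ => h.c3 _ _ _ _
    · intro x y
      obtain ⟨⟨x, rfl⟩, ⟨y, rfl⟩⟩ := And.intro (hmk x) (hmk y)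
      simp only [hRel, ne_eq, hEq, ← Ultrafilter.eventually_not]
      exact fun hx => hx.mono fun _ => h.c4 _ _
  have hNM : ∃ x y : N, x ≠ y := ⟨mk fun _ => m₀, mk fun _ => m₁, by
    rw [ne_eq, hEq]; simpa using hm⟩
  let v' : β ⊕ Unit → N := Sum.elim (fun b => mk fun _ => v b) fun _ => mk y
  -- The second variable becomes a parameter, with value the class of the sequence `y`.
  let φ' : L.Formula ((β ⊕ Unit) ⊕ Fin 1) := φ.relabel
    (Sum.elim (fun b => Sum.inl (Sum.inl b)) ![Sum.inr 0, Sum.inl (Sum.inr ())])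
  have hφ' : ∀ x : N, φ'.Realize (Sum.elim v' ![x]) ↔
      φ.Realize (Sum.elim (fun b => mk fun _ => v b) ![x, mk y]) := by
    intro x
    rw [Formula.realize_relabel]
    have : (Sum.elim v' ![x] ∘ (Sum.elim (fun b => Sum.inl (Sum.inl b))
        ![Sum.inr 0, Sum.inl (Sum.inr ())])) =
        Sum.elim (fun b => mk fun _ => v b) ![x, mk y] := by
      ext (b | i)
      · rfl
      · fin_cases i <;> rfl
    rw [this]
  have hlarge : ∀ i : ℕ, ∀ᶠ k in U, i < k := fun i =>
    (Nat.cofinite_eq_atTop ▸ eventually_gt_atTop i : ∀ᶠ k in cofinite, i < k).filter_mono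
      (hyperfilter_le_cofinite)
  have hinf : {x | φ'.Realize (Sum.elim v' ![x])}.Infinite := by
    -- For fixed `i`, `g k i` is a genuine `i`-th member of the `k`-th set as soon as `k > i`, hence
    -- for almost all `k`.
    refine Set.infinite_of_injective_forall_mem (f := fun i : ℕ => mk fun k => g k i) ?_ ?_
    · intro i j hij
      obtain ⟨k, ⟨hk, hi⟩, hj⟩ :=
        ((((hEq _ _).1 hij).and (hlarge i)).and (hlarge j)).exists
      exact hg k hi hj hk
    · intro i
      refine (hφ' _).2 ((hReal _ _).2 ((hlarge i).mono fun k hk => hφ k i hk))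
  obtain ⟨p, q, hpq, hcone⟩ := ((hmin.hasFiniteBase hN hNC φ' v').finite_or_exists_cone hNC
    hNM).resolve_left hinf
  obtain ⟨⟨p, rfl⟩, ⟨q, rfl⟩⟩ := And.intro (hmk p) (hmk q)
  -- Otherwise each coordinate has a point of its cone outside its fibre; the class of these points
  -- would lie in the cone of `N` but not in the fibre.
  by_contra! hno
  have hpq' : ∀ᶠ i in U, p i ≠ q i := by
    rw [ne_eq, hEq, ← Ultrafilter.eventually_not] at hpq
    exact hpq
  have hx : ∀ i, ∃ x, p i ≠ q i → cRel c M (p i) (q i) x ∧ ¬ φ.Realize (Sum.elim v ![x, y i]) := by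
    intro i
    by_cases hi : p i = q i
    · exact ⟨m₀, fun hi' => (hi' hi).elim⟩
    · obtain ⟨x, hx⟩ := hno (y i) _ _ hi
      exact ⟨x, fun _ => hx⟩
  choose x hx using hx
  have h₁ := (hReal _ _).1 ((hφ' _).1
    (hcone (mk x) ((hRel _ _ _).2 (hpq'.mono fun i hi => (hx i hi).1))))
  obtain ⟨i, hi, hi'⟩ := (h₁.and hpq').exists
  exact (hx i hi').2 hi

end Ultrapower

/-! ### Cones and nodes of the canonical tree. -/

section Cones

variable {M : Type w} {C : M → M → M → Prop} (h : IsCSet C)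

theorem Tree.meet_comm (x y : M) : Tree.meet h x y = Tree.meet h y x :=
  le_antisymm ((Tree.meet_le_meet h _ _ _ _).2 ⟨h.not_C_right _ _, h.not_C_left _ _⟩)
    ((Tree.meet_le_meet h _ _ _ _).2 ⟨h.not_C_right _ _, h.not_C_left _ _⟩)

theorem Tree.meet_le_left (x y : M) : Tree.meet h x y ≤ Tree.leaf h x :=
  (Tree.isGLB_meet h x y).1 (by simp)

theorem Tree.meet_le_right (x y : M) : Tree.meet h x y ≤ Tree.leaf h y :=
  (Tree.isGLB_meet h x y).1 (by simp)

theorem Tree.le_meet {a : Tree h} {x y : M} (hx : a ≤ Tree.leaf h x) (hy : a ≤ Tree.leaf h y) :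
    a ≤ Tree.meet h x y :=
  (Tree.isGLB_meet h x y).2 (by rintro z (rfl | rfl) <;> assumption)

theorem Tree.meet_lt_meet_iff (p q x : M) : Tree.meet h p q < Tree.meet h q x ↔ C p q x := by
  rw [lt_iff_le_not_ge, Tree.meet_le_meet, Tree.meet_le_meet]
  refine ⟨fun hlt => by_contra fun hc => hlt.2 ⟨hc, h.not_C_left _ _⟩, fun hc => ?_⟩
  exact ⟨⟨h.not_C_right _ _, h.c2 _ _ _ (h.c1 _ _ _ hc)⟩, fun hc' => hc'.1 hc⟩

/-- The ultrametric inequality, which makes lying in the same cone at `a` transitive. -/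
theorem Tree.lt_meet_trans {a : Tree h} {x y z : M} (hxy : a < Tree.meet h x y)
    (hyz : a < Tree.meet h y z) : a < Tree.meet h x z := by
  by_cases hc : C z x y
  · have : Tree.meet h y z ≤ Tree.meet h x z :=
      ⟨h.c2 _ _ _ hc ∘ h.c1 _ _ _, h.not_C_right _ _⟩
    exact hyz.trans_le this
  · exact hxy.trans_le ⟨h.not_C_left _ _, hc⟩

theorem Tree.exists_eq_meet {a : Tree h} (ha : a ∈ innerNodes h) :
    ∃ p q, p ≠ q ∧ a = Tree.meet h p q := by
  induction a using Quotient.inductionOn with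
  | h p =>
    refine ⟨p.1, p.2, fun hp => ha p.1 ?_, rfl⟩
    change Tree.meet h p.1 p.2 = _
    rw [← hp]
    rfl

theorem Tree.meet_mem_innerNodes {p q : M} (hpq : p ≠ q) : Tree.meet h p q ∈ innerNodes h := by
  intro α hα
  have hle : Tree.meet h α α ≤ Tree.meet h p q := hα.ge
  have h₁ : p = α := by_contra fun hne => hle.1 (h.c4 _ _ hne)
  have h₂ : q = α := by_contra fun hne => hle.2 (h.c4 _ _ hne)
  exact hpq (h₁.trans h₂.symm)

theorem cone_meet (p q : M) : cone h (Tree.meet h p q) q = {x | C p q x} :=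
  Set.ext fun x => Tree.meet_lt_meet_iff h p q x

theorem setOf_C_mem_cones {p q : M} (hpq : p ≠ q) : {x | C p q x} ∈ cones h := by
  refine Or.inr ⟨Tree.meet h p q, Tree.meet_mem_innerNodes h hpq, q, ?_, (cone_meet h p q).symm⟩
  exact (Tree.meet_lt_meet_iff h p q q).2 (h.c4 _ _ hpq)

theorem eq_cone_of_mem {a : Tree h} {U : Set M} (hU : U ∈ conesAt h a) {x : M} (hx : x ∈ U) :
    U = cone h a x := by
  obtain ⟨α, -, rfl⟩ := hU
  ext y
  refine ⟨fun hy => Tree.lt_meet_trans h ?_ hy, fun hy => Tree.lt_meet_trans h hx hy⟩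
  rw [Tree.meet_comm]
  exact hx

theorem lt_leaf_of_mem {a : Tree h} {U : Set M} (hU : U ∈ conesAt h a) {x : M} (hx : x ∈ U) :
    a < Tree.leaf h x := by
  obtain ⟨α, -, rfl⟩ := hU
  exact lt_of_lt_of_le hx (Tree.meet_le_right h α x)

/-- Every cone at an inner node has the form `{x | C r α x}`. -/
theorem exists_cone_eq_setOf {a : Tree h} (ha : a ∈ innerNodes h) {α : M}
    (hα : a < Tree.leaf h α) : ∃ r, r ≠ α ∧ cone h a α = {x | C r α x} := by
  obtain ⟨p, q, -, rfl⟩ := Tree.exists_eq_meet h ha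
  -- One of `p`, `q` serves: if both were in the cone of `α`, they would meet strictly above their
  -- own meet.
  obtain ⟨r, hr, hr'⟩ : ∃ r, Tree.meet h p q ≤ Tree.leaf h r ∧
      ¬ Tree.meet h p q < Tree.meet h r α := by
    by_contra! hcon
    have h₁ := hcon p (Tree.meet_le_left h p q)
    have h₂ := hcon q (Tree.meet_le_right h p q)
    rw [Tree.meet_comm h q α] at h₂
    exact lt_irrefl _ (Tree.lt_meet_trans h h₁ h₂)
  have heq : Tree.meet h p q = Tree.meet h r α :=
    (Tree.le_meet h hr hα.le).eq_or_lt.resolve_right hr'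
  refine ⟨r, ?_, by rw [heq, cone_meet]⟩
  rintro rfl
  exact hr' hα

/-- Outside finitely many cones at a node with infinitely many cones there are further points. -/
theorem exists_outside_cones {a : Tree h} (ha : (conesAt h a).Infinite) {S : Set M}
    (hS : S.Finite) : ∃ y, a < Tree.leaf h y ∧ ∀ s ∈ S, ¬ a < Tree.meet h y s := by
  obtain ⟨U, hU, hUS⟩ := ha.exists_notMem_finite (hS.image (cone h a))
  obtain ⟨y, hy, rfl⟩ := hU
  refine ⟨y, hy, fun s hs hys => hUS ⟨s, hs, ?_⟩⟩
  exact (eq_cone_of_mem h ⟨y, hy, rfl⟩ hys).symm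

/-- `x` and `y` meet at `a` or above, whereas neither meets a point of `S` strictly above `a`. -/
theorem indiscernible_of_outside_cones {a : Tree h} {S : Set M} {x y : M}
    (hx : a < Tree.leaf h x) (hy : a < Tree.leaf h y) (hxS : ∀ s ∈ S, ¬ a < Tree.meet h x s)
    (hyS : ∀ s ∈ S, ¬ a < Tree.meet h y s) : Indiscernible C S x y := by
  have key : ∀ {x y : M}, a < Tree.leaf h x → a < Tree.leaf h y →
      (∀ s ∈ S, ¬ a < Tree.meet h y s) → ∀ s ∈ S, ¬ C x y s := by
    intro x y hx hy hyS s hs hc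
    exact hyS s hs ((Tree.le_meet h hx.le hy.le).trans_lt ((Tree.meet_lt_meet_iff h x y s).2 hc))
  refine fun s hs => ⟨?_, ?_, key hx hy hyS s hs, key hy hx hxS s hs⟩
  · rintro rfl; exact hxS _ hs hx
  · rintro rfl; exact hyS _ hs hy

end Cones

/-! ### Closure properties of definable predicates. -/

section Definability

open FirstOrder FirstOrder.Language

variable (L : FirstOrder.Language.{u, v}) {M : Type w} [L.Structure M]

/-- The predicate `P` on `n`-tuples is definable with parameters. -/
def DefinablePred (n : ℕ) (P : (Fin n → M) → Prop) : Prop :=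
  ∃ φ : L.BoundedFormula M n, ∀ v, φ.Realize id v ↔ P v

variable {L} {n : ℕ}

theorem DefinablePred.congr {P Q : (Fin n → M) → Prop} (hP : DefinablePred L n P)
    (hPQ : ∀ v, P v ↔ Q v) : DefinablePred L n Q :=
  (funext fun v => propext (hPQ v) : P = Q) ▸ hP

theorem DefinablePred.not {P : (Fin n → M) → Prop} (hP : DefinablePred L n P) :
    DefinablePred L n fun v => ¬ P v := by
  obtain ⟨φ, hφ⟩ := hP
  exact ⟨φ.not, fun v => by rw [BoundedFormula.realize_not, hφ]⟩

theorem DefinablePred.and {P Q : (Fin n → M) → Prop} (hP : DefinablePred L n P)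
    (hQ : DefinablePred L n Q) : DefinablePred L n fun v => P v ∧ Q v := by
  obtain ⟨φ, hφ⟩ := hP
  obtain ⟨ψ, hψ⟩ := hQ
  exact ⟨φ ⊓ ψ, fun v => by rw [BoundedFormula.realize_inf, hφ, hψ]⟩

theorem DefinablePred.ex {P : (Fin (n + 1) → M) → Prop} (hP : DefinablePred L (n + 1) P) :
    DefinablePred L n fun v => ∃ x, P (Fin.snoc v x) := by
  obtain ⟨φ, hφ⟩ := hP
  exact ⟨φ.ex, fun v => by simp only [BoundedFormula.realize_ex, hφ]⟩

theorem DefinablePred.all {P : (Fin (n + 1) → M) → Prop} (hP : DefinablePred L (n + 1) P) :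
    DefinablePred L n fun v => ∀ x, P (Fin.snoc v x) := by
  obtain ⟨φ, hφ⟩ := hP
  exact ⟨φ.all, fun v => by simp only [BoundedFormula.realize_all, hφ]⟩

theorem DefinablePred.cRel (c : L.Relations 3) (r s t : M ⊕ Fin n) :
    DefinablePred L n fun v =>
      cRel c M (Sum.elim id v r) (Sum.elim id v s) (Sum.elim id v t) := by
  refine ⟨Relations.boundedFormula c ![Term.var r, Term.var s, Term.var t], fun v => ?_⟩
  rw [BoundedFormula.realize_rel]
  have : (fun i => ((![Term.var r, Term.var s, Term.var t] : Fin 3 → L.Term (M ⊕ Fin n)) i).realize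
      (Sum.elim id v)) = ![Sum.elim id v r, Sum.elim id v s, Sum.elim id v t] := by
    ext i; fin_cases i <;> rfl
  rw [this]
  rfl

theorem DefinablePred.of_definable₂ {D : Set (M × M)} (hD : (Set.univ : Set M).Definable₂ L D)
    (s t : M ⊕ Fin n) :
    DefinablePred L n fun v => (Sum.elim id v s, Sum.elim id v t) ∈ D := by
  obtain ⟨φ, hφ⟩ := Set.definable_iff_exists_formula_sum.1 hD
  refine ⟨BoundedFormula.relabel (n := n) (k := 0)
    (Sum.elim (fun m : (Set.univ : Set M) => Sum.inl (m : M)) ![s, t]) φ, fun v => ?_⟩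
  have hv := Set.ext_iff.1 hφ ![Sum.elim id v s, Sum.elim id v t]
  refine Iff.trans ?_ hv.symm
  rw [BoundedFormula.realize_relabel, Set.mem_ofPred_eq, Formula.Realize]
  have : (Sum.elim id (v ∘ Fin.castAdd 0) ∘ (Sum.elim (fun m : (Set.univ : Set M) =>
      Sum.inl (m : M)) ![s, t])) = Sum.elim (fun m : (Set.univ : Set M) => (m : M))
        ![Sum.elim id v s, Sum.elim id v t] := by
    ext (m | i)
    · rfl
    · fin_cases i <;> rfl
  rw [this]
  exact iff_of_eq (congrArg _ (Subsingleton.elim _ _))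

theorem DefinablePred.exists_formula {P : (Fin n → M) → Prop} (hP : DefinablePred L n P) :
    ∃ φ : L.Formula (M ⊕ Fin n), ∀ v, φ.Realize (Sum.elim id v) ↔ P v := by
  obtain ⟨φ, hφ⟩ := hP
  refine ⟨φ.toFormula, fun v => ?_⟩
  rw [BoundedFormula.realize_toFormula, Sum.elim_comp_inl, Sum.elim_comp_inr, hφ]

theorem IsCMinimal.hasFiniteBase_of_definablePred {c : L.Relations 3} (hmin : IsCMinimal c M)
    (h : IsCSet (CMinimal.cRel c M)) {P : (Fin 1 → M) → Prop} (hP : DefinablePred L 1 P) :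
    HasFiniteBase (CMinimal.cRel c M) {x | P ![x]} := by
  obtain ⟨φ, hφ⟩ := hP.exists_formula
  simpa only [hφ] using hmin.hasFiniteBase (show M ≅[L] M from rfl) h φ id

end Definability

/-! ### Local constancy of definable maps into the cones at a node. -/

section LocallyConstant

variable {L : FirstOrder.Language.{u, v}} {M : Type w} [L.Structure M] {c : L.Relations 3}

/-- Cones are coded by pairs `p, q` and values by representatives `y`, so local constancy is
first-order. -/
theorem definablePred_not_locallyConstant {R : M → M → Prop}
    (hR : (Set.univ : Set M).Definable₂ L {p | R p.1 p.2}) :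
    DefinablePred L 1 fun v => (∃ y, R (v 0) y) ∧
      ¬ ∃ p q y, cRel c M p q (v 0) ∧ ∀ x, cRel c M p q x → R x y := by
  have hdom : DefinablePred L 1 fun v => ∃ y, R (v 0) y :=
    (DefinablePred.of_definable₂ hR (Sum.inr (0 : Fin 2)) (Sum.inr 1)).ex
  have hconst : DefinablePred L 4 fun v => ∀ x, cRel c M (v 1) (v 2) x → R x (v 3) :=
    ((DefinablePred.cRel c (Sum.inr (1 : Fin 5)) (Sum.inr 2) (Sum.inr 4)).and
      (DefinablePred.of_definable₂ hR (Sum.inr (4 : Fin 5)) (Sum.inr 3)).not).not.all.congr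
        fun v => forall_congr' fun x => not_and_not_right
  exact hdom.and (((DefinablePred.cRel c (Sum.inr (1 : Fin 4)) (Sum.inr 2)
    (Sum.inr 0)).and hconst).ex.ex.ex).not

/-- Let `R` be (the graph of) a definable map from the cone `{x | C p q x}` to the set of cones
at `a`. Then `R` is constant on some cone contained in `{x | C p q x}`. -/
theorem IsCMinimal.exists_cone_constant (hC : IsDenseCSet (cRel c M)) (hmin : IsCMinimal c M)
    (hbn : ∀ b ∈ innerNodes hC.toIsCSet, (conesAt hC.toIsCSet b).Infinite)
    {a : Tree hC.toIsCSet} (ha : a ∈ innerNodes hC.toIsCSet) {R : M → M → Prop}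
    (hR : (Set.univ : Set M).Definable₂ L {p | R p.1 p.2})
    (hlt : ∀ x y, R x y → a < Tree.leaf hC.toIsCSet y)
    (hcone : ∀ x y y', R x y → a < Tree.meet hC.toIsCSet y y' → R x y')
    {p₀ q₀ : M} (hpq₀ : p₀ ≠ q₀) (hdom : ∀ x, cRel c M p₀ q₀ x → ∃ y, R x y) :
    ∃ y p q, p ≠ q ∧ ∀ x, cRel c M p q x → cRel c M p₀ q₀ x ∧ R x y := by
  have h := hC.toIsCSet
  by_contra hno
  have hfib : ∀ y, {x | cRel c M p₀ q₀ x ∧ R x y}.Finite := by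
    intro y
    have hdef : DefinablePred L 1 fun v : Fin 1 → M => cRel c M p₀ q₀ (v 0) ∧ R (v 0) y :=
      (DefinablePred.cRel c (Sum.inl p₀) (Sum.inl q₀) (Sum.inr (0 : Fin 1))).and
        (DefinablePred.of_definable₂ hR (Sum.inr 0) (Sum.inl y))
    refine ((hmin.hasFiniteBase_of_definablePred h hdef).finite_or_exists_cone h
      hC.exists_ne).resolve_right ?_
    rintro ⟨p, q, hpq, hsub⟩
    exact hno ⟨y, p, q, hpq, hsub⟩
  -- By density there is a node `b` strictly above `inf(p₀, q₀)`; all cones at `b` lie in the given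
  -- cone.
  obtain ⟨z, hz, hCz⟩ := hC.dense p₀ q₀ hpq₀
  have hb := Tree.meet_mem_innerNodes h hz.symm
  set b := Tree.meet h q₀ z
  let V := (hbn b hb).natEmbedding
  choose α hα hV using fun i => (V i).2
  choose r hr hrcone using fun i => exists_cone_eq_setOf h hb (hα i)
  have hsub : ∀ i x, cRel c M (r i) (α i) x → cRel c M p₀ q₀ x := by
    intro i x hx
    have hx' : b < Tree.meet h (α i) x := by
      have : x ∈ cone h b (α i) := (hrcone i).symm ▸ hx
      exact this
    rw [← Tree.meet_lt_meet_iff h] at hCz ⊢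
    exact hCz.trans_le (Tree.le_meet h (Tree.meet_le_left h _ _)
      (hx'.le.trans (Tree.meet_le_right h _ _)))
  have himage : ∀ i, ∃ S : Set M, S.Finite ∧ ∀ y, a < Tree.leaf h y →
      (∀ s ∈ S, ¬ a < Tree.meet h y s) → ∃ x, cRel c M (r i) (α i) x ∧ R x y := by
    intro i
    have hdef : DefinablePred L 1 fun v : Fin 1 → M =>
        ∃ x, cRel c M (r i) (α i) x ∧ R x (v 0) :=
      ((DefinablePred.cRel c (Sum.inl (r i)) (Sum.inl (α i)) (Sum.inr (1 : Fin 2))).and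
        (DefinablePred.of_definable₂ hR (Sum.inr 1) (Sum.inr 0))).ex
    obtain ⟨S, hS, hSD⟩ := hmin.hasFiniteBase_of_definablePred h hdef
    refine ⟨S, hS, ?_⟩
    -- Otherwise the infinite cone `V i` would be covered by the finitely many finite fibres over
    -- `S`.
    obtain ⟨y₀, x₀, hx₀, hy₀, hyS₀⟩ : ∃ y₀ x₀, cRel c M (r i) (α i) x₀ ∧ R x₀ y₀ ∧
        ∀ s ∈ S, ¬ a < Tree.meet h y₀ s := by
      by_contra! hcon
      refine hC.infinite_cone (hr i) ((hS.biUnion fun s _ => hfib s).subset fun x hx => ?_)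
      obtain ⟨y, hy⟩ := hdom x (hsub i x hx)
      obtain ⟨s, hs, hlts⟩ := hcon y x hx hy
      exact Set.mem_biUnion hs ⟨hsub i x hx, hcone x y s hy hlts⟩
    intro y hy hyS
    exact hSD y₀ y (indiscernible_of_outside_cones h (hlt _ _ hy₀) hy hyS₀ hyS) ⟨x₀, hx₀, hy₀⟩
  choose S hS hSim using himage
  have hdef : DefinablePred L 2 fun v : Fin 2 → M => cRel c M p₀ q₀ (v 0) ∧ R (v 0) (v 1) :=
    (DefinablePred.cRel c (Sum.inl p₀) (Sum.inl q₀) (Sum.inr (0 : Fin 2))).and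
      (DefinablePred.of_definable₂ hR (Sum.inr 0) (Sum.inr 1))
  obtain ⟨φ, hφ⟩ := hdef.exists_formula
  have hunb := hmin.exists_cone_of_unbounded h hC.exists_ne φ id fun k => by
    obtain ⟨y, hy, hyS⟩ := exists_outside_cones h (hbn a ha)
      ((Set.finite_Iio k).biUnion fun i _ => hS i)
    have hg : ∀ i, ∃ x, i < k → cRel c M (r i) (α i) x ∧ R x y := by
      intro i
      by_cases hi : i < k
      · obtain ⟨x, hx⟩ := hSim i y hy fun s hs => hyS s (Set.mem_biUnion hi hs)
        exact ⟨x, fun _ => hx⟩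
      · exact ⟨p₀, fun hi' => (hi hi').elim⟩
    choose g hg using hg
    refine ⟨y, g, fun i hi j hj hij => ?_, fun i hi => ?_⟩
    -- The points `g i` are distinct because a point lies in only one cone at `b`.
    · have hmem : ∀ i < k, g i ∈ (V i : Set M) := by
        intro i hi
        rw [hV i, hrcone i]
        exact (hg i hi).1
      apply V.injective
      apply Subtype.ext
      rw [eq_cone_of_mem h (V i).2 (hmem i hi), eq_cone_of_mem h (V j).2 (hmem j hj), hij]
    · exact (hφ _).2 ⟨hsub i _ (hg i hi).1, (hg i hi).2⟩
  obtain ⟨y, p, q, hpq, hx⟩ := hunb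
  exact hno ⟨y, p, q, hpq, fun x hxc => (hφ _).1 (hx x hxc)⟩

end LocallyConstant

end CMinimal

theorem mainTheorem8 {L : FirstOrder.Language.{u, v}} {M : Type w} [L.Structure M]
    (c : L.Relations 3)
    (hC : CMinimal.IsDenseCSet (CMinimal.cRel c M))
    (hmin : CMinimal.IsCMinimal c M)
    (hbn : ∀ b ∈ CMinimal.innerNodes hC.toIsCSet, (CMinimal.conesAt hC.toIsCSet b).Infinite)
    (hbr : ∀ α : M, DenselyOrdered (CMinimal.branch hC.toIsCSet α))
    (a : CMinimal.Tree hC.toIsCSet) (ha : a ∈ CMinimal.innerNodes hC.toIsCSet)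
    (f : M →. CMinimal.conesAt hC.toIsCSet a) (hf : CMinimal.DefinableToCones L f) :
    ∃ X : Set M, X ⊆ f.Dom ∧ (f.Dom \ X).Finite ∧
      CMinimal.LocallyConstantOn hC.toIsCSet f X := by
  have h := hC.toIsCSet
  -- Replacing a cone by its points turns `f` into a definable relation on `M`.
  let R : M → M → Prop := fun x y => ∃ U ∈ f x, y ∈ (U : Set M)
  have hR : (Set.univ : Set M).Definable₂ L {p | R p.1 p.2} := hf
  have hdom : ∀ x, x ∈ f.Dom ↔ ∃ y, R x y := by
    intro x
    rw [PFun.mem_dom]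
    refine ⟨fun ⟨U, hU⟩ => ?_, fun ⟨_, U, hU, _⟩ => ⟨U, hU⟩⟩
    obtain ⟨α, hα, hUα⟩ := U.2
    exact ⟨α, U, hU, by rw [hUα]; exact hα⟩
  let X : Set M := {x | ∃ p q y, CMinimal.cRel c M p q x ∧
    ∀ x', CMinimal.cRel c M p q x' → R x' y}
  refine ⟨X, ?_, ?_, ?_⟩
  · rintro x ⟨p, q, y, hx, hconst⟩
    exact (hdom x).2 ⟨y, hconst x hx⟩
  · have hbad : f.Dom \ X = {x | (∃ y, R x y) ∧ ¬ ∃ p q y, CMinimal.cRel c M p q x ∧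
        ∀ x', CMinimal.cRel c M p q x' → R x' y} :=
      Set.ext fun x => and_congr_left' (hdom x)
    rw [hbad]
    refine ((hmin.hasFiniteBase_of_definablePred h
      (CMinimal.definablePred_not_locallyConstant (c := c) hR)).finite_or_exists_cone h
        hC.exists_ne).resolve_right ?_
    rintro ⟨p₀, q₀, hpq₀, hsub⟩
    obtain ⟨y, p, q, hpq, hy⟩ := hmin.exists_cone_constant hC hbn ha hR
      (fun x y ⟨U, _, hy⟩ => CMinimal.lt_leaf_of_mem h U.2 hy)
      (fun x y y' ⟨U, hU, hy⟩ hyy' =>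
        ⟨U, hU, by rw [CMinimal.eq_cone_of_mem h U.2 hy]; exact hyy'⟩)
      hpq₀ fun x hx => (hsub x hx).1
    have hq := h.c4 _ _ hpq
    -- The point `q` of the subcone is then both bad and a point of local constancy.
    exact (hsub q (hy q hq).1).2 ⟨p, q, y, hq, fun x hx => (hy x hx).2⟩
  · rintro x ⟨p, q, y, hx, hconst⟩
    have hpq : p ≠ q := by
      rintro rfl
      exact h.not_C_left _ _ hx
    refine ⟨_, CMinimal.setOf_C_mem_cones h hpq, hx, fun x' hx' => ⟨p, q, y, hx', hconst⟩, ?_⟩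
    -- All the values contain `y`, and only one cone at `a` does.
    obtain ⟨U, hU, hyU⟩ := hconst x hx
    refine ⟨U, fun x' hx' => ?_⟩
    obtain ⟨U', hU', hyU'⟩ := hconst x' hx'
    have : U = U' := Subtype.ext (by
      rw [CMinimal.eq_cone_of_mem h U.2 hyU, CMinimal.eq_cone_of_mem h U'.2 hyU'])
    rwa [this]
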